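/- **Every abstract polytope can be constructed as a coset geometry.** Let $\mathcal P$ be an abstract polytope of rank $n\ge 0$, i.e. a poset with a least and a greatest element, all of whose maximal chains (flags) have exactly $n+2$ elements, satisfying the diamond condition (for every flag $\Phi$ and $i\in\{0,\dots,n-1\}$ there is exactly one flag $\Phi^i$ differing from $\Phi$ precisely in the face of rank $i$) and strong flag connectedness (any two flags $\Phi,\Psi$ are joined by a sequence of successively adjacent flags all containing $\Phi\cap\Psi$). Let $\Gamma$ be any group of automorphisms of $\mathcal P$, acting on the right (for instance the full automorphism group), and let $X$ be the symmetry type graph of $\mathcal P$ with respect to $\Gamma$: its vertices are the $\Gamma$-orbits of flags, and each vertex is incident to exactly one edge of each colour $i\in\{0,\dots,n-1\}$, joining the orbit of $\Phi$ to the orbit of $\Phi^i$ (a semi-edge if these orbits coincide). Then $X$ is a premaniplex: it is connected, and its paths of length $4$ alternating between two colours $i,j$ with $|i-j|>1$ are closed. Moreover there is a voltage assignment $\xi$ on $X$ with values in $\Gamma$, that is, a map from the darts (directed edges) of $X$ to $\Gamma$ with $\xi(d^{-1})=\xi(d)^{-1}$, extended to paths by $\xi(d_1\cdots d_k)=\xi(d_k)\cdots\xi(d_1)$,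 which is trivial on the paths of length $4$ alternating between two colours $i,j$ with $|i-j|>1$, such that the following hold. 1. The derived graph $X^\xi$ (vertices $(x,g)$ with $x$ a vertex of $X$ and $g\in\Gamma$; for each dart $d$ of colour $i$ from $x$ to $y$, an $i$-coloured edge from $(x,g)$ to $(y,\xi(d)g)$) is isomorphic, as an edge-coloured graph, to the flag graph of $\mathcal P$ (whose vertices are the flags, $\Phi$ and $\Phi^i$ being joined by an edge of colour $i$). The isomorphism can be chosen to commute with $\Gamma$, acting on $X^\xi$ by $(x,g)\gamma=(x,g\gamma)$, and to be compatible with the projections to $X$. 2. For a set $I$ of colours and vertices $x,y$ of $X$, let $\xi(\Pi^{x,y}_I(X))$ be the set of voltages of the paths from $x$ to $y$ using only colours in $I$. Then $\xi(\Pi^{x,y}_I(X))\cap\xi(\Pi^{x,y}_J(X))=\xi(\Pi^{x,y}_{I\cap J}(X))$ for all $I,J,x,y$. 3. Let $X_{\bar i}$ be the graph obtained from $X$ by deleting the edges of colour $i$. Choose, in any way, a base vertex $f(C)$ in each connected component $C$ of each $X_{\bar i}$ and, for each colour $i$ and vertex $y$ of $X$, a path $W_i^y$ in $X_{\bar i}$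 from the base vertex of the component of $y$ to $y$; put $\alpha_i^y=\xi(W_i^y)$. For a component $C$ of $X_{\bar i}$, let $H_{i,C}=\xi(\Pi^{x,x}_{\bar i}(X))\le\Gamma$ with $x=f(C)$, the image under $\xi$ of the fundamental group of $C$ based at $x$. Let $\mathcal P(X,\xi)$ have, as its faces of rank $i\in\{0,\dots,n-1\}$, the pairs $(C,H_{i,C}\gamma)$ with $C$ a component of $X_{\bar i}$ and $\gamma\in\Gamma$ (faces of different ranks being regarded as different), together with a least and a greatest face, of ranks $-1$ and $n$. For faces of ranks $i,j\in\{0,\dots,n-1\}$ put $(C,H_{i,C}\gamma)<(C',H_{j,C'}\gamma')$ if and only if $i<j$ and, for some vertex $y\in C\cap C'$, $$\alpha_i^y\,H_{i,C}\,\gamma\;\cap\;\alpha_j^y\,H_{j,C'}\,\gamma'\neq\emptyset .$$ Then $\mathcal P$ is isomorphic to $\mathcal P(X,\xi)$ as a ranked poset, by an isomorphism commuting with $\Gamma$, which acts on $\mathcal P(X,\xi)$ by right multiplication of the cosets and fixes the least and the greatest face. -/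

import Mathlib

open scoped Pointwise

universe u v

namespace PolytopeCoset

/-! ### Abstract polytopes -/

section Polytope

variable {P : Type u} [PartialOrder P]

/-- In a poset with a least element all of whose maximal chains have the same finite
cardinality, the faces of rank `i` (where the least face has rank `-1`) are the elements
of height `i + 1`. -/
def HasRank (F : P) (i : ℕ) : Prop := Order.height F = (i : ℕ∞) + 1

/-- Two flags (maximal chains) are `i`-adjacent if they differ exactly in their face of rank `i`. -/
def FlagAdj (i : ℕ) (Φ Ψ : Flag P) : Prop :=
  Φ ≠ Ψ ∧ ∀ F : P, ¬ HasRank F i → (F ∈ Φ ↔ F ∈ Ψ)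

/-- `P` (a poset with a least and a greatest element) is an abstract polytope of rank `n`. -/
structure IsAbstractPolytope (P : Type u) [PartialOrder P] [BoundedOrder P] (n : ℕ) : Prop where
  /-- every maximal chain has exactly `n + 2` elements -/
  card_flag : ∀ Φ : Flag P, (Φ : Set P).encard = ((n + 2 : ℕ) : ℕ∞)
  /-- the diamond condition -/
  diamond : ∀ (Φ : Flag P) (i : Fin n), ∃! Ψ : Flag P, FlagAdj (i : ℕ) Φ Ψ
  /-- strong flag connectedness -/
  strongly_connected : ∀ Φ Ψ : Flag P,
    Relation.ReflTransGen
      (fun A B : Flag P => (∃ i : Fin n, FlagAdj (i : ℕ) A B) ∧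
        (Φ : Set P) ∩ (Ψ : Set P) ⊆ (A : Set P) ∧ (Φ : Set P) ∩ (Ψ : Set P) ⊆ (B : Set P))
      Φ Ψ

/-- The automorphism group of a poset, acting on the right:
the product `γ * δ` is "first `γ`, then `δ`". -/
abbrev AutGroup (P : Type u) [PartialOrder P] : Type u := (P ≃o P)ᵐᵒᵖ

/-- The image `F γ` of a face under an automorphism. -/
def faceAct (F : P) (γ : AutGroup P) : P := γ.unop F

/-- The image `Φ γ` of a flag under an automorphism. -/
def flagAct (Φ : Flag P) (γ : AutGroup P) : Flag P := Flag.map γ.unop Φ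

theorem mem_flagAct {Φ : Flag P} {γ : AutGroup P} {F : P} :
    F ∈ flagAct Φ γ ↔ γ.unop.symm F ∈ Φ := by
  constructor
  · rintro ⟨G, hG, rfl⟩
    simpa using hG
  · intro h
    exact ⟨_, h, by simp⟩

theorem flagAct_one (Φ : Flag P) : flagAct Φ 1 = Φ :=
  SetLike.ext fun _ => mem_flagAct

theorem flagAct_mul (Φ : Flag P) (γ δ : AutGroup P) :
    flagAct Φ (γ * δ) = flagAct (flagAct Φ γ) δ :=
  SetLike.ext fun _ => by simp only [mem_flagAct]; rfl

theorem FlagAdj.symm {i : ℕ} {Φ Ψ : Flag P} (h : FlagAdj i Φ Ψ) : FlagAdj i Ψ Φ :=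
  ⟨h.1.symm, fun F hF => (h.2 F hF).symm⟩

theorem FlagAdj.act {i : ℕ} {Φ Ψ : Flag P} (h : FlagAdj i Φ Ψ) (γ : AutGroup P) :
    FlagAdj i (flagAct Φ γ) (flagAct Ψ γ) := by
  refine ⟨fun e => h.1 ((Flag.map γ.unop).injective e), fun F hF => ?_⟩
  rw [mem_flagAct, mem_flagAct]
  refine h.2 _ fun hr => hF ?_
  unfold HasRank at hr ⊢
  rwa [Order.height_orderIso] at hr

end Polytope

/-! ### Edge-coloured graphs, premaniplexes, voltages -/

/-- A graph whose edges are coloured with `0, …, n-1`, in which every vertex is incident to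
exactly one edge of each colour.  Semi-edges (`nbr i x = x`) and parallel edges of different
colours are allowed; the edge of colour `i` at `x` joins `x` to `nbr i x`. -/
structure ColoredGraph (n : ℕ) where
  V : Type u
  nbr : Fin n → V → V
  nbr_nbr : ∀ i x, nbr i (nbr i x) = x

namespace ColoredGraph

variable {n : ℕ}

/-- A dart (directed edge) is determined by its initial vertex and its colour. -/
structure Dart (X : ColoredGraph.{u} n) where
  init : X.V
  color : Fin n

/-- The terminal vertex of a dart. -/
def Dart.term {X : ColoredGraph.{u} n} (d : X.Dart) : X.V := X.nbr d.color d.init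

/-- The inverse dart; the dart of a semi-edge is its own inverse. -/
def Dart.inv {X : ColoredGraph.{u} n} (d : X.Dart) : X.Dart := ⟨d.term, d.color⟩

/-- Paths from `x` to `y` all of whose darts have colours in `I`. -/
inductive Path (X : ColoredGraph.{u} n) (I : Set (Fin n)) : X.V → X.V → Type u
  | nil (x : X.V) : Path X I x x
  | cons {y : X.V} (d : X.Dart) (hd : d.color ∈ I) (W : Path X I d.term y) : Path X I d.init y

/-- Concatenation of paths. -/
def Path.append {X : ColoredGraph.{u} n} {I : Set (Fin n)} {z : X.V} :
    {x y : X.V} → Path X I x y → Path X I y z → Path X I x z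
  | _, _, .nil _, W => W
  | _, _, .cons d hd V, W => .cons d hd (V.append W)

theorem Dart.term_inv {X : ColoredGraph.{u} n} (d : X.Dart) : d.inv.term = d.init :=
  X.nbr_nbr d.color d.init

/-- The path consisting of the single dart `d⁻¹`. -/
def Path.single_inv {X : ColoredGraph.{u} n} {I : Set (Fin n)} (d : X.Dart) (hd : d.color ∈ I) :
    Path X I d.term d.init :=
  .cons d.inv hd (d.term_inv.symm ▸ .nil d.init)

/-- The reversed path. -/
def Path.reverse {X : ColoredGraph.{u} n} {I : Set (Fin n)} :
    {x y : X.V} → Path X I x y → Path X I y x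
  | _, _, .nil x => .nil x
  | _, _, .cons d hd W => W.reverse.append (.single_inv d hd)

/-- Being joined by a path with colours in `I`. -/
def connSetoid (X : ColoredGraph.{u} n) (I : Set (Fin n)) : Setoid X.V where
  r x y := Nonempty (Path X I x y)
  iseqv := ⟨fun x => ⟨.nil x⟩, fun ⟨W⟩ => ⟨W.reverse⟩, fun ⟨W⟩ ⟨W'⟩ => ⟨W.append W'⟩⟩

/-- The connected components of `X_I`, the subgraph of `X` given by the edges with colours
in `I`. -/
def Component (X : ColoredGraph.{u} n) (I : Set (Fin n)) : Type u := Quotient (X.connSetoid I)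

/-- The connected component `X_I(x)` of `X_I` containing the vertex `x`. -/
def component (X : ColoredGraph.{u} n) (I : Set (Fin n)) (x : X.V) : X.Component I :=
  Quotient.mk (X.connSetoid I) x

/-- `|i - j| > 1`. -/
def Nonconsecutive (i j : Fin n) : Prop := (i : ℕ) + 1 < j ∨ (j : ℕ) + 1 < i

/-- An `n`-premaniplex: connected, and the paths of length 4 that alternate between two
non-consecutive colours are closed. -/
structure IsPremaniplex (X : ColoredGraph.{u} n) : Prop where
  nonempty : Nonempty X.V
  connected : ∀ x y : X.V, Nonempty (Path X Set.univ x y)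
  closed : ∀ i j : Fin n, Nonconsecutive i j →
    ∀ x : X.V, X.nbr j (X.nbr i (X.nbr j (X.nbr i x))) = x

/-- A voltage assignment on `X` with voltage group `Γ`, given by the voltages of the darts:
inverse darts have inverse voltages, and the paths of length 4 alternating between two
non-consecutive colours have trivial voltage (that is, the voltage of a path is invariant
under maniplex-homotopy). -/
structure VoltageAssignment (X : ColoredGraph.{u} n) (Γ : Type v) [Group Γ] where
  dart : X.Dart → Γ
  dart_inv : ∀ d : X.Dart, dart d.inv = (dart d)⁻¹
  dart_square : ∀ i j : Fin n, Nonconsecutive i j → ∀ x : X.V,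
    dart ⟨X.nbr i (X.nbr j (X.nbr i x)), j⟩ * dart ⟨X.nbr j (X.nbr i x), i⟩ *
      dart ⟨X.nbr i x, j⟩ * dart ⟨x, i⟩ = 1

variable {X : ColoredGraph.{u} n} {Γ : Type v} [Group Γ]

namespace VoltageAssignment

/-- The voltage `ξ(d_k) ⋯ ξ(d_1)` of the path `d_1 ⋯ d_k`. -/
def voltage (ξ : VoltageAssignment X Γ) {I : Set (Fin n)} :
    {x y : X.V} → Path X I x y → Γ
  | _, _, .nil _ => 1
  | _, _, .cons d _ W => ξ.voltage W * ξ.dart d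

theorem voltage_append (ξ : VoltageAssignment X Γ) {I : Set (Fin n)} {x y z : X.V}
    (V : Path X I x y) (W : Path X I y z) :
    ξ.voltage (V.append W) = ξ.voltage W * ξ.voltage V := by
  induction V with
  | nil x => simp [Path.append, voltage]
  | cons d hd V ih => simp [Path.append, voltage, ih, mul_assoc]

theorem voltage_single_inv (ξ : VoltageAssignment X Γ) {I : Set (Fin n)} (d : X.Dart)
    (hd : d.color ∈ I) : ξ.voltage (Path.single_inv d hd) = (ξ.dart d)⁻¹ := by
  have key : ∀ (a b : X.V) (h : a = b), ξ.voltage (h.symm ▸ Path.nil b : Path X I a b) = 1 := by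
    rintro a _ rfl
    rfl
  show ξ.voltage (d.term_inv.symm ▸ Path.nil d.init : Path X I d.inv.term d.init) *
    ξ.dart d.inv = _
  rw [key _ _ d.term_inv, one_mul, ξ.dart_inv]

theorem voltage_reverse (ξ : VoltageAssignment X Γ) {I : Set (Fin n)} {x y : X.V}
    (W : Path X I x y) : ξ.voltage W.reverse = (ξ.voltage W)⁻¹ := by
  induction W with
  | nil x => simp [Path.reverse, voltage]
  | cons d hd W ih =>
    simp [Path.reverse, voltage_append, voltage_single_inv, voltage, ih]

/-- `ξ(Π_I^{x,y}(X))`: the set of voltages of the paths from `x` to `y` with colours in `I`. -/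
def voltageSet (ξ : VoltageAssignment X Γ) (I : Set (Fin n)) (x y : X.V) : Set Γ :=
  Set.range (fun W : Path X I x y => ξ.voltage W)

/-- `ξ(Π_I^x(X))`: the image under `ξ` of the fundamental group, based at `x`, of the connected
component `X_I(x)`. -/
def voltageGroup (ξ : VoltageAssignment X Γ) (I : Set (Fin n)) (x : X.V) : Subgroup Γ where
  carrier := ξ.voltageSet I x x
  one_mem' := ⟨.nil x, rfl⟩
  mul_mem' := by
    rintro _ _ ⟨V, rfl⟩ ⟨W, rfl⟩
    exact ⟨W.append V, ξ.voltage_append W V⟩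
  inv_mem' := by
    rintro _ ⟨W, rfl⟩
    exact ⟨W.reverse, ξ.voltage_reverse W⟩

/-- The intersection property for the voltages of paths. -/
def IntersectionProperty (ξ : VoltageAssignment X Γ) : Prop :=
  ∀ (I J : Set (Fin n)) (x y : X.V),
    ξ.voltageSet I x y ∩ ξ.voltageSet J x y = ξ.voltageSet (I ∩ J) x y

/-- The derived graph `X^ξ`: the dart `(d, g)` goes from `(x, g)` to `(y, ξ(d) g)` if `d` goes
from `x` to `y`. -/
def derivedGraph (ξ : VoltageAssignment X Γ) : ColoredGraph.{max u v} n where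
  V := X.V × Γ
  nbr i p := (X.nbr i p.1, ξ.dart ⟨p.1, i⟩ * p.2)
  nbr_nbr i p := by
    have h : ξ.dart ⟨X.nbr i p.1, i⟩ = (ξ.dart ⟨p.1, i⟩)⁻¹ := ξ.dart_inv ⟨p.1, i⟩
    ext
    · exact X.nbr_nbr i p.1
    · simp [h]

end VoltageAssignment

/-! ### The coset geometry -/

/-- A base vertex `f(C)` in each connected component `C` of each `X_{ī}` (where `ī` is the set
of all colours different from `i`), and, for each vertex `y`, a path `W_i^y` in `X_{ī}` from
the base vertex of the component of `y` to `y`. -/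
structure BaseData (X : ColoredGraph.{u} n) where
  base : ∀ i : Fin n, X.Component {i}ᶜ → X.V
  base_mem : ∀ (i : Fin n) (C : X.Component {i}ᶜ), X.component {i}ᶜ (base i C) = C
  path : ∀ (i : Fin n) (y : X.V), Path X {i}ᶜ (base i (X.component {i}ᶜ y)) y

/-- A (proper) face of the coset geometry: a formal copy, labelled by a colour `i` (the rank) and
a connected component `C` of `X_{ī}`, of a right coset `ξ(Π_{ī}^{f(C)}(X)) γ` in `Γ`. -/
structure CosetFace (ξ : VoltageAssignment X Γ) (B : BaseData X) where
  rank : Fin n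
  comp : X.Component {rank}ᶜ
  coset : Set Γ
  isCoset : ∃ γ : Γ,
    coset = MulOpposite.op γ • (ξ.voltageGroup {rank}ᶜ (B.base rank comp) : Set Γ)

/-- Incidence: faces of ranks `i < j`, labelled by `C` and `C'`, satisfy `H γ < H' γ'` if and only
if `α_i^y H γ ∩ α_j^y H' γ'` is non-empty for some vertex `y ∈ C ∩ C'`, where `α_i^y` is the
voltage of the path `W_i^y`. -/
instance CosetFace.instLT (ξ : VoltageAssignment X Γ) (B : BaseData X) : LT (CosetFace ξ B) where
  lt a b := a.rank < b.rank ∧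
    ∃ y : X.V, X.component {a.rank}ᶜ y = a.comp ∧ X.component {b.rank}ᶜ y = b.comp ∧
      ((ξ.voltage (B.path a.rank y) • a.coset) ∩ (ξ.voltage (B.path b.rank y) • b.coset)).Nonempty

/-- `Γ` acts on the faces of the coset geometry by right multiplication. -/
def CosetFace.act {ξ : VoltageAssignment X Γ} {B : BaseData X} (γ : Γ) (a : CosetFace ξ B) :
    CosetFace ξ B where
  rank := a.rank
  comp := a.comp
  coset := MulOpposite.op γ • a.coset
  isCoset := by
    obtain ⟨δ, h⟩ := a.isCoset
    exact ⟨δ * γ, by rw [h, smul_smul, MulOpposite.op_mul]⟩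

/-- The coset geometry, with its least and greatest faces adjoined (of ranks `-1` and `n`). -/
abbrev CosetGeometry (ξ : VoltageAssignment X Γ) (B : BaseData X) : Type (max u v) :=
  WithBot (WithTop (CosetFace ξ B))

/-- The action of `Γ` on the coset geometry; it fixes the least and the greatest face. -/
def CosetGeometry.act {ξ : VoltageAssignment X Γ} {B : BaseData X} (F : CosetGeometry ξ B)
    (γ : Γ) : CosetGeometry ξ B :=
  WithBot.map (WithTop.map (CosetFace.act γ)) F

end ColoredGraph

/-! ### Flag graphs and symmetry type graphs -/

section STG

variable {P : Type u} [PartialOrder P] [BoundedOrder P] {n : ℕ}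

/-- The flag graph of an abstract polytope: flags `Φ` and `Ψ` are joined by an edge of colour `i`
if and only if they are `i`-adjacent. -/
noncomputable def flagGraph (hP : IsAbstractPolytope P n) : ColoredGraph.{u} n where
  V := Flag P
  nbr i Φ := (hP.diamond Φ i).choose
  nbr_nbr i Φ := by
    have h1 := (hP.diamond Φ i).choose_spec.1
    have h2 := (hP.diamond (hP.diamond Φ i).choose i).choose_spec.2
    exact (h2 Φ h1.symm).symm

theorem flagAdj_nbr (hP : IsAbstractPolytope P n) (i : Fin n) (Φ : Flag P) :
    FlagAdj (i : ℕ) Φ ((flagGraph hP).nbr i Φ) :=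
  (hP.diamond Φ i).choose_spec.1

theorem eq_nbr (hP : IsAbstractPolytope P n) (i : Fin n) {Φ Ψ : Flag P}
    (h : FlagAdj (i : ℕ) Φ Ψ) : Ψ = (flagGraph hP).nbr i Φ :=
  (hP.diamond Φ i).choose_spec.2 Ψ h

/-- Two flags are equivalent if they lie in the same orbit of the group `G` of automorphisms. -/
def orbitSetoid (G : Subgroup (AutGroup P)) : Setoid (Flag P) where
  r Φ Ψ := ∃ γ ∈ G, flagAct Φ γ = Ψ
  iseqv := by
    refine ⟨fun Φ => ⟨1, G.one_mem, flagAct_one Φ⟩, ?_, ?_⟩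
    · rintro Φ _ ⟨γ, hγ, rfl⟩
      exact ⟨γ⁻¹, G.inv_mem hγ, by rw [← flagAct_mul, mul_inv_cancel, flagAct_one]⟩
    · rintro Φ _ _ ⟨γ, hγ, rfl⟩ ⟨δ, hδ, rfl⟩
      exact ⟨γ * δ, G.mul_mem hγ hδ, flagAct_mul Φ γ δ⟩

/-- The symmetry type graph of `P` with respect to a group `G` of automorphisms: the vertices are
the flag orbits under `G`, and the `i`-edge at the orbit of `Φ` leads to the orbit of the flag
`i`-adjacent to `Φ`. -/
noncomputable def symmetryTypeGraph (hP : IsAbstractPolytope P n) (G : Subgroup (AutGroup P)) :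
    ColoredGraph.{u} n where
  V := Quotient (orbitSetoid G)
  nbr i := Quotient.map ((flagGraph hP).nbr i) (by
    rintro Φ _ ⟨γ, hγ, rfl⟩
    exact ⟨γ, hγ, eq_nbr hP i ((flagAdj_nbr hP i Φ).act γ)⟩)
  nbr_nbr i := by
    rintro ⟨Φ⟩
    exact congrArg (Quotient.mk (orbitSetoid G)) ((flagGraph hP).nbr_nbr i Φ)

/-- The orbit of a flag, as a vertex of the symmetry type graph. -/
def flagOrbit (hP : IsAbstractPolytope P n) (G : Subgroup (AutGroup P)) (Φ : Flag P) :
    (symmetryTypeGraph hP G).V :=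
  Quotient.mk (orbitSetoid G) Φ

end STG

end PolytopeCoset

/-!
# Abstract polytopes as coset geometries

All maximal chains have `n + 2` elements, so heights are injective on a flag and every flag `Φ` has
exactly one face of each rank.  For a set `I` of colours, call two flags `I`-equivalent if they have
the same faces of all ranks outside `I`.  Strong flag connectedness says precisely that
`I`-equivalent flags are joined by adjacencies with colours in `I`
(`IsAbstractPolytope.AgreeOff.reflTransGen`), and it also implies that automorphisms act freely on
flags (`eq_one_of_flagAct_eq`).

Choose a base flag `Φ_x` in each orbit `x`.  By freeness every flag is `Φ_x g` for exactly one pair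
`(x, g)`, and the voltage `ξ(d)` of the dart of colour `i` from `x` to `y` is defined by
`(Φ_x)^i = Φ_y ξ(d)`.  This makes the flag graph the derived graph.  The condition on the paths of
length 4 holds because adjacencies of non-consecutive ranks commute (`nbr_comm`).

Lifting paths of the symmetry type graph to the flag graph shows that `g` is the voltage of a path
from `x` to `y` with colours in `I` if and only if `Φ_x` and `Φ_y g` are `I`-equivalent
(`mem_voltageSet`).  Being both `I`- and `J`-equivalent is the same as being
`I ∩ J`-equivalent, which gives the intersection property.  For `I` the complement of `{i}` it
follows that two vertices are in the same component if and only if the `i`-faces of their base flags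
are in the same orbit, and that `H_{i,C}` is the stabilizer of the `i`-face of the base flag of
`f(C)`.  The pair `(C, H_{i,C} γ)` therefore encodes the image of this face under `γ`
(`toFace`), and every face of rank `i` arises exactly once.  The translate `α_i^y H_{i,C} γ` is the
set of `k` for which that face is the `i`-face of `Φ_y k` (`mem_voltage_smul_coset`), so two
translates meet exactly when the two faces lie in a common flag (`lt_iff_toFace_lt`).
-/

namespace PolytopeCoset

open ColoredGraph

/-! ### Ranks and flags -/

section Order

variable {P : Type u} [PartialOrder P]

theorem lt_of_height_lt {Φ : Flag P} {F F' : P} (hF : F ∈ Φ) (hF' : F' ∈ Φ)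
    (h : Order.height F < Order.height F') : F < F' := by
  rcases Φ.le_or_le hF hF' with h' | h'
  · exact lt_of_le_of_ne h' fun e => h.ne (by rw [e])
  · exact absurd h (not_lt.2 (Order.height_mono h'))

theorem HasRank.unique {F : P} {i j : ℕ} (h : HasRank F i) (h' : HasRank F j) : i = j := by
  unfold HasRank at h h'
  rw [h] at h'
  norm_cast at h'
  omega

theorem HasRank.height_lt_height_iff {F F' : P} {i j : ℕ} (h : HasRank F i) (h' : HasRank F' j) :
    Order.height F < Order.height F' ↔ i < j := by
  rw [show Order.height F = _ from h, show Order.height F' = _ from h']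
  norm_cast
  omega

theorem hasRank_faceAct {F : P} {i : ℕ} (h : HasRank F i) (γ : AutGroup P) :
    HasRank (faceAct F γ) i := by
  unfold HasRank faceAct at *
  rwa [Order.height_orderIso]

theorem faceAct_mem_flagAct {Φ : Flag P} {F : P} (h : F ∈ Φ) (γ : AutGroup P) :
    faceAct F γ ∈ flagAct Φ γ :=
  ⟨F, h, rfl⟩

theorem faceAct_one (F : P) : faceAct F 1 = F := rfl

theorem faceAct_mul (F : P) (γ δ : AutGroup P) :
    faceAct F (γ * δ) = faceAct (faceAct F γ) δ := rfl

theorem exists_flag_mem (F : P) : ∃ Φ : Flag P, F ∈ Φ := by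
  obtain ⟨Φ, hΦ⟩ := (IsChain.singleton (a := F) (r := (· ≤ ·))).exists_subset_flag
  exact ⟨Φ, hΦ rfl⟩

theorem exists_flag_mem_mem {F F' : P} (h : F ≤ F') : ∃ Φ : Flag P, F ∈ Φ ∧ F' ∈ Φ := by
  obtain ⟨Φ, hΦ⟩ := (IsChain.pair h).exists_subset_flag
  exact ⟨Φ, hΦ (by simp), hΦ (by simp)⟩

end Order

section Flags

variable {P : Type u} [PartialOrder P] [BoundedOrder P] {n : ℕ}

/-- Every strictly increasing sequence is contained in a flag. -/
theorem IsAbstractPolytope.height_le (hP : IsAbstractPolytope P n) (F : P) :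
    Order.height F ≤ ((n + 1 : ℕ) : ℕ∞) := by
  refine Order.height_le fun p _ => ?_
  have hc : IsChain (· ≤ ·) (Set.range p) := p.strictMono.monotone.isChain_range
  obtain ⟨Φ, hΦ⟩ := hc.exists_subset_flag
  have h1 := Set.encard_le_encard hΦ
  rw [hP.card_flag, ← Set.image_univ, p.strictMono.injective.encard_image, Set.encard_univ] at h1
  simp only [ENat.card_eq_coe_fintype_card, Fintype.card_fin] at h1
  norm_cast at h1 ⊢
  omega

theorem IsAbstractPolytope.height_lt (hP : IsAbstractPolytope P n) {F F' : P} (h : F < F') :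
    Order.height F < Order.height F' :=
  Order.height_strictMono h ((hP.height_le F).trans_lt (ENat.natCast_lt_top _))

theorem IsAbstractPolytope.eq_of_height_eq (hP : IsAbstractPolytope P n) {Φ : Flag P} {F F' : P}
    (hF : F ∈ Φ) (hF' : F' ∈ Φ) (h : Order.height F = Order.height F') : F = F' := by
  by_contra hne
  rcases Φ.le_or_le hF hF' with h' | h'
  · exact (hP.height_lt (lt_of_le_of_ne h' hne)).ne h
  · exact (hP.height_lt (lt_of_le_of_ne h' (Ne.symm hne))).ne h.symm

/-- Heights are injective on a flag and take at most the `n + 2` values `0, …, n + 1`, so each of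
these values is attained. -/
theorem IsAbstractPolytope.exists_mem_height (hP : IsAbstractPolytope P n) (Φ : Flag P) {k : ℕ}
    (hk : k ≤ n + 1) : ∃ F ∈ Φ, Order.height F = k := by
  have hfin : ∀ F : P, Order.height F ≠ ⊤ := fun F =>
    ((hP.height_le F).trans_lt (ENat.natCast_lt_top _)).ne
  have hinj : Set.InjOn (fun F : P => (Order.height F).toNat) (Φ : Set P) := by
    intro F hF F' hF' h
    exact hP.eq_of_height_eq hF hF' (by
      rw [← ENat.natCast_toNat (hfin F), ← ENat.natCast_toNat (hfin F')]
      exact congrArg _ h)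
  have hsub : (fun F : P => (Order.height F).toNat) '' (Φ : Set P) ⊆ Set.Iic (n + 1) := by
    rintro _ ⟨F, -, rfl⟩
    exact ENat.toNat_le_of_le_natCast (hP.height_le F)
  have heq := ((Set.finite_Iic (n + 1)).subset hsub).eq_of_subset_of_encard_le hsub (by
    rw [hinj.encard_image, hP.card_flag, ← Finset.coe_Iic, Set.encard_coe_eq_coe_finsetCard,
      Nat.card_Iic])
  obtain ⟨F, hF, h⟩ : k ∈ (fun F : P => (Order.height F).toNat) '' (Φ : Set P) := by
    rw [heq]; exact hk
  exact ⟨F, hF, by rw [← h, ENat.natCast_toNat (hfin F)]⟩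

theorem IsAbstractPolytope.exists_mem_height_eq (hP : IsAbstractPolytope P n) (Φ : Flag P)
    (F : P) : ∃ F' ∈ Φ, Order.height F' = Order.height F := by
  obtain ⟨k, hk⟩ := ENat.ne_top_iff_exists.1 ((hP.height_le F).trans_lt (ENat.natCast_lt_top _)).ne
  have h := hP.height_le F
  rw [← hk] at h ⊢
  exact hP.exists_mem_height Φ (by exact_mod_cast h)

theorem IsAbstractPolytope.exists_mem_hasRank (hP : IsAbstractPolytope P n) (Φ : Flag P)
    (i : Fin n) : ∃ F ∈ Φ, HasRank F (i : ℕ) := by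
  obtain ⟨F, hF, h⟩ := hP.exists_mem_height Φ (k := i + 1) (by omega)
  exact ⟨F, hF, by rw [HasRank, h]; rfl⟩

theorem IsAbstractPolytope.eq_of_hasRank (hP : IsAbstractPolytope P n) {Φ : Flag P}
    {F F' : P} {i : ℕ} (hF : F ∈ Φ) (hF' : F' ∈ Φ) (h : HasRank F i) (h' : HasRank F' i) : F = F' :=
  hP.eq_of_height_eq hF hF' (Eq.trans h (Eq.symm h'))

/-- The face of rank `i` of the flag `Φ`. -/
noncomputable def IsAbstractPolytope.face (hP : IsAbstractPolytope P n) (Φ : Flag P) (i : Fin n) :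
    P :=
  (hP.exists_mem_hasRank Φ i).choose

variable (hP : IsAbstractPolytope P n)

theorem IsAbstractPolytope.face_mem (Φ : Flag P) (i : Fin n) : hP.face Φ i ∈ Φ :=
  (hP.exists_mem_hasRank Φ i).choose_spec.1

theorem IsAbstractPolytope.face_hasRank (Φ : Flag P) (i : Fin n) :
    HasRank (hP.face Φ i) (i : ℕ) :=
  (hP.exists_mem_hasRank Φ i).choose_spec.2

theorem IsAbstractPolytope.eq_face {Φ : Flag P} {F : P} {i : Fin n} (hF : F ∈ Φ)
    (h : HasRank F (i : ℕ)) : F = hP.face Φ i :=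
  hP.eq_of_hasRank hF (hP.face_mem Φ i) h (hP.face_hasRank Φ i)

theorem IsAbstractPolytope.face_flagAct (Φ : Flag P) (γ : AutGroup P) (i : Fin n) :
    hP.face (flagAct Φ γ) i = faceAct (hP.face Φ i) γ :=
  (hP.eq_face (faceAct_mem_flagAct (hP.face_mem Φ i) γ)
    (hasRank_faceAct (hP.face_hasRank Φ i) γ)).symm

theorem FlagAdj.face_eq {i j : Fin n} {Φ Ψ : Flag P} (h : FlagAdj (i : ℕ) Φ Ψ) (hij : j ≠ i) :
    hP.face Φ j = hP.face Ψ j :=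
  hP.eq_face ((h.2 _ fun hr => hij (Fin.ext ((hP.face_hasRank Φ j).unique hr))).1
    (hP.face_mem Φ j)) (hP.face_hasRank Φ j)

theorem FlagAdj.face_ne {i : Fin n} {Φ Ψ : Flag P} (h : FlagAdj (i : ℕ) Φ Ψ) :
    hP.face Φ i ≠ hP.face Ψ i := by
  intro e
  refine h.1 (SetLike.ext fun F => ?_)
  by_cases hF : HasRank F (i : ℕ)
  · constructor
    · intro hm
      rw [hP.eq_face hm hF, e]
      exact hP.face_mem Ψ i
    · intro hm
      rw [hP.eq_face hm hF, ← e]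
      exact hP.face_mem Φ i
  · exact h.2 F hF

theorem nbr_flagAct (i : Fin n) (Φ : Flag P) (γ : AutGroup P) :
    (flagGraph hP).nbr i (flagAct Φ γ) = flagAct ((flagGraph hP).nbr i Φ) γ :=
  (eq_nbr hP i ((flagAdj_nbr hP i Φ).act γ)).symm

/-! ### Commutation of adjacencies of non-consecutive ranks -/

/-- A face of rank `j` incident to the `k`-faces of `Φ` for all `k ≠ i, j` is also incident to the
`i`-face of `Φ`, since there is a rank strictly between `i` and `j`.  So the `j`-face of `Φ` may be
exchanged before its `i`-face. -/
theorem nbr_comm {i j : Fin n} (hij : Nonconsecutive i j) (Φ : Flag P) :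
    (flagGraph hP).nbr j ((flagGraph hP).nbr i Φ) =
      (flagGraph hP).nbr i ((flagGraph hP).nbr j Φ) := by
  have hne : j ≠ i := by
    rintro rfl
    unfold Nonconsecutive at hij
    omega
  have hA : FlagAdj (i : ℕ) Φ ((flagGraph hP).nbr i Φ) := flagAdj_nbr hP i Φ
  set A : Flag P := (flagGraph hP).nbr i Φ
  have hB : FlagAdj (j : ℕ) A ((flagGraph hP).nbr j A) := flagAdj_nbr hP j A
  set B : Flag P := (flagGraph hP).nbr j A
  have hΦB : ∀ F : P, ¬ HasRank F (i : ℕ) → ¬ HasRank F (j : ℕ) → (F ∈ Φ ↔ F ∈ B) :=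
    fun F h h' => (hA.2 F h).trans (hB.2 F h')
  have hrank := hP.face_hasRank B j
  have hmem := hP.face_mem B j
  have hcomp : ∀ F ∈ Φ, ¬ HasRank F (j : ℕ) → hP.face B j ≤ F ∨ F ≤ hP.face B j := by
    intro F hF hFj
    by_cases hFi : HasRank F (i : ℕ)
    · -- Compare both faces with a face of `Φ` of a rank strictly between `i` and `j`.
      rcases hij with h | h
      · have hM := hP.face_mem Φ ⟨i + 1, by omega⟩
        have hMr := hP.face_hasRank Φ ⟨i + 1, by omega⟩
        have hMB := (hΦB _ (fun h' => by have := hMr.unique h'; simp at this)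
          (fun h' => by have := hMr.unique h'; simp at this; omega)).1 hM
        right
        exact (lt_of_height_lt hF hM ((hFi.height_lt_height_iff hMr).2 (by simp))).le.trans
          (lt_of_height_lt hMB hmem ((hMr.height_lt_height_iff hrank).2 (by simpa using h))).le
      · have hM := hP.face_mem Φ ⟨j + 1, by omega⟩
        have hMr := hP.face_hasRank Φ ⟨j + 1, by omega⟩
        have hMB := (hΦB _ (fun h' => by have := hMr.unique h'; simp at this; omega)
          (fun h' => by have := hMr.unique h'; simp at this)).1 hM
        left
        exact (lt_of_height_lt hmem hMB ((hrank.height_lt_height_iff hMr).2 (by simp))).le.trans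
          (lt_of_height_lt hM hF ((hMr.height_lt_height_iff hFi).2 (by simpa using h))).le
    · exact B.le_or_le hmem ((hΦB F hFi hFj).1 hF)
  -- Exchanging the `j`-face of `Φ` for that of `B` gives a chain, contained in a flag `C`, which
  -- is `j`-adjacent to `Φ` and `i`-adjacent to `B`.
  have hchain : IsChain (· ≤ ·) (insert (hP.face B j) {F | F ∈ Φ ∧ ¬ HasRank F (j : ℕ)}) := by
    refine IsChain.insert (fun F hF F' hF' _ => Φ.le_or_le hF.1 hF'.1) ?_
    exact fun F hF _ => hcomp F hF.1 hF.2
  obtain ⟨C, hC⟩ := hchain.exists_subset_flag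
  have hfC : hP.face B j ∈ C := hC (Set.mem_insert _ _)
  have hΦC : ∀ F : P, ¬ HasRank F (j : ℕ) → (F ∈ Φ ↔ F ∈ C) := by
    intro F hF
    refine ⟨fun h => hC (Set.mem_insert_of_mem _ ⟨h, hF⟩), fun h => ?_⟩
    obtain ⟨F', hF', e⟩ := hP.exists_mem_height_eq Φ F
    have : F' ∈ C := hC (Set.mem_insert_of_mem _ ⟨hF', fun hr => hF (e.symm.trans hr)⟩)
    rwa [← hP.eq_of_height_eq this h e]
  have hadj : FlagAdj (j : ℕ) Φ C := by
    refine ⟨?_, hΦC⟩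
    rintro rfl
    exact hB.face_ne hP ((hA.face_eq hP hne).symm.trans (hP.eq_face hfC hrank).symm)
  have hadj' : FlagAdj (i : ℕ) C B := by
    refine ⟨fun e => ?_, fun F hF => ?_⟩
    · apply hA.face_ne hP
      rw [hadj.face_eq hP hne.symm, hB.face_eq hP hne.symm, e]
    · by_cases hFj : HasRank F (j : ℕ)
      · constructor
        · intro h
          rwa [hP.eq_of_hasRank h hfC hFj hrank]
        · intro h
          rwa [hP.eq_of_hasRank h hmem hFj hrank]
      · exact (hΦC F hFj).symm.trans (hΦB F hF hFj)
  have e1 : C = (flagGraph hP).nbr j Φ := eq_nbr hP j hadj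
  rw [← e1]
  exact eq_nbr hP i hadj'

theorem nbr_square {i j : Fin n} (hij : Nonconsecutive i j) (Φ : Flag P) :
    (flagGraph hP).nbr j ((flagGraph hP).nbr i ((flagGraph hP).nbr j
      ((flagGraph hP).nbr i Φ))) = Φ := by
  refine (congrArg (fun A => (flagGraph hP).nbr j ((flagGraph hP).nbr i A))
    (nbr_comm hP hij Φ)).trans ?_
  exact (congrArg ((flagGraph hP).nbr j) ((flagGraph hP).nbr_nbr i _)).trans
    ((flagGraph hP).nbr_nbr j Φ)

/-! ### Flags sharing faces -/

/-- `Φ` and `Ψ` have the same faces of all ranks outside `I`. -/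
def IsAbstractPolytope.AgreeOff (I : Set (Fin n)) (Φ Ψ : Flag P) : Prop :=
  ∀ i ∉ I, hP.face Φ i = hP.face Ψ i

theorem IsAbstractPolytope.AgreeOff.act {hP : IsAbstractPolytope P n} {I : Set (Fin n)}
    {Φ Ψ : Flag P} (h : hP.AgreeOff I Φ Ψ) (γ : AutGroup P) :
    hP.AgreeOff I (flagAct Φ γ) (flagAct Ψ γ) := fun i hi => by
  rw [hP.face_flagAct, hP.face_flagAct, h i hi]

theorem IsAbstractPolytope.AgreeOff.trans {hP : IsAbstractPolytope P n} {I : Set (Fin n)}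
    {Φ Ψ Ω : Flag P} (h : hP.AgreeOff I Φ Ψ) (h' : hP.AgreeOff I Ψ Ω) : hP.AgreeOff I Φ Ω :=
  fun i hi => (h i hi).trans (h' i hi)

theorem IsAbstractPolytope.agreeOff_nbr {I : Set (Fin n)} {i : Fin n} (hi : i ∈ I) (Φ : Flag P) :
    hP.AgreeOff I Φ ((flagGraph hP).nbr i Φ) := fun j hj =>
  (flagAdj_nbr hP i Φ).face_eq hP (by rintro rfl; exact hj hi)

theorem IsAbstractPolytope.agreeOff_compl_singleton {i : Fin n} {Φ Ψ : Flag P} :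
    hP.AgreeOff {i}ᶜ Φ Ψ ↔ hP.face Φ i = hP.face Ψ i := by
  simp [IsAbstractPolytope.AgreeOff]

/-- Strong flag connectedness in terms of colours: flags agreeing in all ranks outside `I` are
joined by a path with colours in `I`.  A step of colour `i ∉ I` cannot occur among flags
containing `Φ ∩ Ψ`, because the common `i`-face of `Φ` and `Ψ` would be in both its ends. -/
theorem IsAbstractPolytope.AgreeOff.reflTransGen {hP : IsAbstractPolytope P n} {I : Set (Fin n)}
    {Φ Ψ : Flag P} (h : hP.AgreeOff I Φ Ψ) :
    Relation.ReflTransGen (fun A B : Flag P => ∃ i ∈ I, B = (flagGraph hP).nbr i A) Φ Ψ := by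
  refine Relation.ReflTransGen.mono ?_ _ _ (hP.strongly_connected Φ Ψ)
  rintro A B ⟨⟨i, hi⟩, hA, hB⟩
  refine ⟨i, ?_, eq_nbr hP i hi⟩
  by_contra hiI
  have hmem : hP.face Φ i ∈ (Φ : Set P) ∩ (Ψ : Set P) :=
    ⟨hP.face_mem Φ i, by rw [h i hiI]; exact hP.face_mem Ψ i⟩
  exact hi.face_ne hP ((hP.eq_face (hA hmem) (hP.face_hasRank Φ i)).symm.trans
    (hP.eq_face (hB hmem) (hP.face_hasRank Φ i)))

/-- Automorphisms act freely on flags. -/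
theorem eq_one_of_flagAct_eq {hP : IsAbstractPolytope P n} {Φ : Flag P} {γ : AutGroup P}
    (h : flagAct Φ γ = Φ) : γ = 1 := by
  have hall : ∀ Ψ : Flag P, flagAct Ψ γ = Ψ := by
    intro Ψ
    have hag : hP.AgreeOff Set.univ Φ Ψ := fun i hi => absurd (Set.mem_univ i) hi
    have hconn := hag.reflTransGen
    clear hag
    induction hconn with
    | refl => exact h
    | tail _ hstep ih =>
      obtain ⟨i, -, rfl⟩ := hstep
      exact (nbr_flagAct hP i _ γ).symm.trans (congrArg ((flagGraph hP).nbr i) ih)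
  apply MulOpposite.unop_injective
  ext F
  obtain ⟨Ψ, hΨ⟩ := exists_flag_mem F
  refine hP.eq_of_height_eq (Φ := Ψ) ?_ hΨ (Order.height_orderIso _ _)
  have := faceAct_mem_flagAct hΨ γ
  rwa [hall] at this

end Flags

/-! ### Base flags and voltages -/

section Voltage

variable {P : Type u} [PartialOrder P] [BoundedOrder P] {n : ℕ}
  (hP : IsAbstractPolytope P n) (G : Subgroup (AutGroup P))

/-- A chosen flag in each orbit. -/
noncomputable def baseFlag (x : (symmetryTypeGraph hP G).V) : Flag P :=
  Quotient.out (s := orbitSetoid G) x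

variable {hP G}

theorem flagOrbit_baseFlag (x : (symmetryTypeGraph hP G).V) :
    flagOrbit hP G (baseFlag hP G x) = x :=
  Quotient.out_eq (s := orbitSetoid G) x

theorem flagOrbit_flagAct (Φ : Flag P) (g : G) :
    flagOrbit hP G (flagAct Φ (g : AutGroup P)) = flagOrbit hP G Φ :=
  (Quotient.sound (s := orbitSetoid G) ⟨g, g.2, rfl⟩).symm

theorem exists_baseFlag_act (Φ : Flag P) :
    ∃ g : G, flagAct (baseFlag hP G (flagOrbit hP G Φ)) (g : AutGroup P) = Φ := by
  obtain ⟨γ, hγ, h⟩ := Quotient.exact (s := orbitSetoid G) (flagOrbit_baseFlag (flagOrbit hP G Φ))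
  exact ⟨⟨γ, hγ⟩, h⟩

theorem baseFlag_act_inj {x y : (symmetryTypeGraph hP G).V} {g h : G}
    (e : flagAct (baseFlag hP G x) (g : AutGroup P) = flagAct (baseFlag hP G y) (h : AutGroup P)) :
    x = y ∧ g = h := by
  have hxy : x = y := by
    have := congrArg (flagOrbit hP G) e
    rwa [flagOrbit_flagAct, flagOrbit_flagAct, flagOrbit_baseFlag, flagOrbit_baseFlag] at this
  subst hxy
  refine ⟨rfl, ?_⟩
  have h1 : flagAct (baseFlag hP G x) ((g : AutGroup P) * (h : AutGroup P)⁻¹) =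
      baseFlag hP G x := by
    rw [flagAct_mul, e, ← flagAct_mul, mul_inv_cancel, flagAct_one]
  exact Subtype.ext (mul_inv_eq_one.1 (eq_one_of_flagAct_eq (hP := hP) h1))

theorem exists_dart_voltage (x : (symmetryTypeGraph hP G).V) (i : Fin n) :
    ∃ g : G, flagAct (baseFlag hP G ((symmetryTypeGraph hP G).nbr i x)) (g : AutGroup P) =
      (flagGraph hP).nbr i (baseFlag hP G x) := by
  have h : flagOrbit hP G ((flagGraph hP).nbr i (baseFlag hP G x)) =
      (symmetryTypeGraph hP G).nbr i x :=
    congrArg ((symmetryTypeGraph hP G).nbr i) (flagOrbit_baseFlag x)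
  rw [← h]
  exact exists_baseFlag_act _

variable (hP G) in
/-- The voltage `g` of the dart of colour `i` at `x`: the flag `i`-adjacent to the base flag of `x`
is the image under `g` of the base flag of its orbit. -/
noncomputable def dartVoltage (d : (symmetryTypeGraph hP G).Dart) : G :=
  (exists_dart_voltage d.init d.color).choose

theorem nbr_baseFlag_act (x : (symmetryTypeGraph hP G).V) (i : Fin n) (g : G) :
    (flagGraph hP).nbr i (flagAct (baseFlag hP G x) (g : AutGroup P)) =
      flagAct (baseFlag hP G ((symmetryTypeGraph hP G).nbr i x))
        ((dartVoltage hP G ⟨x, i⟩ * g : G) : AutGroup P) := by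
  rw [nbr_flagAct, ← (exists_dart_voltage x i).choose_spec, Subgroup.coe_mul, flagAct_mul]
  rfl

variable (hP G) in
/-- The voltage assignment on the symmetry type graph determined by the base flags. -/
noncomputable def stgVoltage : VoltageAssignment (symmetryTypeGraph hP G) G where
  dart := dartVoltage hP G
  dart_inv := by
    rintro ⟨x, i⟩
    have h := (flagGraph hP).nbr_nbr i (flagAct (baseFlag hP G x) ((1 : G) : AutGroup P))
    rw [nbr_baseFlag_act, nbr_baseFlag_act, mul_one] at h
    exact eq_inv_of_mul_eq_one_left (baseFlag_act_inj h).2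
  dart_square := by
    intro i j hij x
    have h := nbr_square hP hij (flagAct (baseFlag hP G x) ((1 : G) : AutGroup P))
    rw [nbr_baseFlag_act, nbr_baseFlag_act, nbr_baseFlag_act, nbr_baseFlag_act] at h
    simpa [mul_assoc] using (baseFlag_act_inj h).2

/-- The lift to the flag graph, from the base flag of `x`, of a path from `x` to `y` ends at the
image of the base flag of `y` under the voltage of the path. -/
theorem agreeOff_voltage {I : Set (Fin n)} {x y : (symmetryTypeGraph hP G).V}
    (W : Path (symmetryTypeGraph hP G) I x y) :
    hP.AgreeOff I (baseFlag hP G x)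
      (flagAct (baseFlag hP G y) ((stgVoltage hP G).voltage W : AutGroup P)) := by
  induction W with
  | nil x => exact fun i _ => congrArg (hP.face · i) (flagAct_one _).symm
  | cons d hd W ih =>
    refine (hP.agreeOff_nbr hd (baseFlag hP G d.init)).trans ?_
    have h := ih.act (dartVoltage hP G d : AutGroup P)
    rw [← flagAct_mul] at h
    have h' := nbr_baseFlag_act (hP := hP) d.init d.color (1 : G)
    rw [mul_one, Subgroup.coe_one, flagAct_one] at h'
    rw [h']
    exact h

/-- A path of flags projects to a path of the symmetry type graph, whose voltage is found by
comparing the ends of the path of flags with the base flags. -/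
theorem exists_path_of_reflTransGen {I : Set (Fin n)} {y : (symmetryTypeGraph hP G).V} {h : G}
    {Φ : Flag P} (hΦ : Relation.ReflTransGen
      (fun A B : Flag P => ∃ i ∈ I, B = (flagGraph hP).nbr i A) Φ
      (flagAct (baseFlag hP G y) (h : AutGroup P))) :
    ∀ (x : (symmetryTypeGraph hP G).V) (g : G), flagAct (baseFlag hP G x) (g : AutGroup P) = Φ →
      ∃ W : Path (symmetryTypeGraph hP G) I x y, (stgVoltage hP G).voltage W * g = h := by
  induction hΦ using Relation.ReflTransGen.head_induction_on with
  | refl =>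
    intro x g e
    obtain ⟨rfl, rfl⟩ := baseFlag_act_inj e
    exact ⟨.nil x, one_mul g⟩
  | head hstep _ ih =>
    rintro x g rfl
    obtain ⟨i, hi, rfl⟩ := hstep
    obtain ⟨W, hW⟩ := ih _ _ (nbr_baseFlag_act x i g).symm
    refine ⟨.cons ⟨x, i⟩ hi W, ?_⟩
    rw [← hW, ← mul_assoc]
    rfl

/-- The paths with colours in `I` starting at `x` lift to the paths of flags starting at the base
flag of `x`, so the voltages of the paths from `x` to `y` are described by the faces of flags. -/
theorem mem_voltageSet {I : Set (Fin n)} {x y : (symmetryTypeGraph hP G).V} {g : G} :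
    g ∈ (stgVoltage hP G).voltageSet I x y ↔
      hP.AgreeOff I (baseFlag hP G x) (flagAct (baseFlag hP G y) (g : AutGroup P)) := by
  constructor
  · rintro ⟨W, rfl⟩
    exact agreeOff_voltage W
  · intro h
    obtain ⟨W, hW⟩ := exists_path_of_reflTransGen h.reflTransGen x 1 (flagAct_one _)
    exact ⟨W, by simpa using hW⟩

theorem stgVoltage_intersectionProperty : (stgVoltage hP G).IntersectionProperty := by
  intro I J x y
  ext g
  simp only [Set.mem_inter_iff, mem_voltageSet]
  constructor
  · rintro ⟨h, h'⟩ i hi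
    by_cases hI : i ∈ I
    · exact h' i fun hJ => hi ⟨hI, hJ⟩
    · exact h i hI
  · exact fun h => ⟨fun i hi => h i fun hi' => hi hi'.1, fun i hi => h i fun hi' => hi hi'.2⟩

theorem symmetryTypeGraph_isPremaniplex : (symmetryTypeGraph hP G).IsPremaniplex where
  nonempty := (exists_flag_mem (⊥ : P)).elim fun Φ _ => ⟨flagOrbit hP G Φ⟩
  connected x y := by
    obtain ⟨W, -⟩ := (mem_voltageSet (hP := hP) (x := x) (y := y) (g := (1 : G))).2
      (fun i hi => absurd (Set.mem_univ i) hi)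
    exact ⟨W⟩
  closed i j hij := by
    rintro ⟨Φ⟩
    exact congrArg (flagOrbit hP G) (nbr_square hP hij Φ)

variable (hP G) in
/-- The isomorphism from the derived graph to the flag graph: `(x, g)` goes to the image under `g`
of the base flag of `x`. -/
noncomputable def derivedGraphEquiv :
    (stgVoltage hP G).derivedGraph.V ≃ (flagGraph hP).V :=
  Equiv.ofBijective
    (fun p : (symmetryTypeGraph hP G).V × G => flagAct (baseFlag hP G p.1) (p.2 : AutGroup P))
    ⟨fun _ _ e => Prod.ext (baseFlag_act_inj e).1 (baseFlag_act_inj e).2, fun Φ =>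
      (exists_baseFlag_act Φ).elim fun g hg => ⟨(flagOrbit hP G Φ, g), hg⟩⟩

theorem exists_derivedGraph_iso :
    ∃ θ : (flagGraph hP).V ≃ (stgVoltage hP G).derivedGraph.V,
      (∀ (i : Fin n) (Φ : (flagGraph hP).V),
        θ ((flagGraph hP).nbr i Φ) = (stgVoltage hP G).derivedGraph.nbr i (θ Φ)) ∧
      (∀ Φ : Flag P, (θ Φ).1 = flagOrbit hP G Φ) ∧
      (∀ (Φ : Flag P) (γ : G), θ (flagAct Φ (γ : AutGroup P)) = ((θ Φ).1, (θ Φ).2 * γ)) := by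
  have hsymm : ∀ (x : (symmetryTypeGraph hP G).V) (g : G),
      (derivedGraphEquiv hP G).symm (flagAct (baseFlag hP G x) (g : AutGroup P)) = (x, g) :=
    fun x g => (derivedGraphEquiv hP G).symm_apply_apply (x, g)
  have hsurj : ∀ Φ : Flag P, ∃ (x : (symmetryTypeGraph hP G).V) (g : G),
      flagAct (baseFlag hP G x) (g : AutGroup P) = Φ :=
    fun Φ => ⟨_, exists_baseFlag_act Φ⟩
  refine ⟨(derivedGraphEquiv hP G).symm, fun i Φ => ?_, fun Φ => ?_, fun Φ γ => ?_⟩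
  · obtain ⟨x, g, rfl⟩ := hsurj Φ
    rw [nbr_baseFlag_act, hsymm, hsymm]
    rfl
  · obtain ⟨x, g, rfl⟩ := hsurj Φ
    rw [hsymm, flagOrbit_flagAct, flagOrbit_baseFlag]
  · obtain ⟨x, g, rfl⟩ := hsurj Φ
    rw [← flagAct_mul, ← Subgroup.coe_mul, hsymm, hsymm]

theorem component_eq_iff {I : Set (Fin n)} {x y : (symmetryTypeGraph hP G).V} :
    (symmetryTypeGraph hP G).component I x = (symmetryTypeGraph hP G).component I y ↔
      ∃ g : G, hP.AgreeOff I (baseFlag hP G x) (flagAct (baseFlag hP G y) (g : AutGroup P)) := by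
  constructor
  · intro h
    obtain ⟨W⟩ := Quotient.exact (s := (symmetryTypeGraph hP G).connSetoid I) h
    exact ⟨_, agreeOff_voltage W⟩
  · rintro ⟨g, hg⟩
    obtain ⟨W, -⟩ := mem_voltageSet.2 hg
    exact Quotient.sound (s := (symmetryTypeGraph hP G).connSetoid I) ⟨W⟩

theorem component_eq_of_face {i : Fin n} {x y : (symmetryTypeGraph hP G).V} {g h : G}
    (e : faceAct (hP.face (baseFlag hP G x) i) (g : AutGroup P) =
      faceAct (hP.face (baseFlag hP G y) i) (h : AutGroup P)) :
    (symmetryTypeGraph hP G).component {i}ᶜ x = (symmetryTypeGraph hP G).component {i}ᶜ y := by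
  refine component_eq_iff.2 ⟨h * g⁻¹, hP.agreeOff_compl_singleton.2 ?_⟩
  rw [hP.face_flagAct, Subgroup.coe_mul, faceAct_mul, ← e, ← faceAct_mul, Subgroup.coe_inv,
    mul_inv_cancel, faceAct_one]

end Voltage

/-! ### Faces of the coset geometry -/

section Faces

variable {P : Type u} [PartialOrder P] [BoundedOrder P] {n : ℕ}
  {hP : IsAbstractPolytope P n} {G : Subgroup (AutGroup P)}
  {B : BaseData (symmetryTypeGraph hP G)}

/-- `H_{i,C}` is the stabilizer of the `i`-face of the base flag of `f(C)`. -/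
theorem mem_voltageGroup {i : Fin n} {x : (symmetryTypeGraph hP G).V} {g : G} :
    g ∈ (stgVoltage hP G).voltageGroup {i}ᶜ x ↔
      faceAct (hP.face (baseFlag hP G x) i) (g : AutGroup P) = hP.face (baseFlag hP G x) i := by
  rw [← hP.face_flagAct, eq_comm, ← hP.agreeOff_compl_singleton]
  exact mem_voltageSet

/-- The `i`-face of the base flag of `f(C)`, for the component `C` labelling the face `a` of
rank `i` of the coset geometry. -/
noncomputable def baseFace (a : CosetFace (stgVoltage hP G) B) : P :=
  hP.face (baseFlag hP G (B.base a.rank a.comp)) a.rank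

theorem coset_nonempty (a : CosetFace (stgVoltage hP G) B) : a.coset.Nonempty := by
  obtain ⟨γ, h⟩ := a.isCoset
  exact ⟨γ, by rw [h, mem_rightCoset_iff, mul_inv_cancel]; exact one_mem _⟩

/-- The face of `P` represented by the face `(C, H γ)` of the coset geometry: the image under `γ`
of the face of the base flag whose stabilizer is `H`. -/
noncomputable def toFace (a : CosetFace (stgVoltage hP G) B) : P :=
  faceAct (baseFace a) ((coset_nonempty a).some : AutGroup P)

theorem mem_coset {a : CosetFace (stgVoltage hP G) B} {g : G} :
    g ∈ a.coset ↔ faceAct (baseFace a) (g : AutGroup P) = toFace a := by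
  have key : ∀ γ : G, a.coset = MulOpposite.op γ •
      ((stgVoltage hP G).voltageGroup {a.rank}ᶜ (B.base a.rank a.comp) : Set G) →
      ∀ g : G, g ∈ a.coset ↔
        faceAct (baseFace a) (g : AutGroup P) = faceAct (baseFace a) (γ : AutGroup P) := by
    intro γ h g
    rw [h, mem_rightCoset_iff, SetLike.mem_coe, mem_voltageGroup, Subgroup.coe_mul, faceAct_mul,
      Subgroup.coe_inv]
    constructor
    · intro e
      have := congrArg (fun F => faceAct F (γ : AutGroup P)) e
      simpa only [baseFace, ← faceAct_mul, mul_assoc, inv_mul_cancel, mul_one] using this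
    · intro e
      change faceAct (faceAct (baseFace a) _) _ = baseFace a
      rw [e, ← faceAct_mul, mul_inv_cancel, faceAct_one]
  obtain ⟨γ, h⟩ := a.isCoset
  rw [key γ h, toFace, (key γ h _).1 (coset_nonempty a).some_mem]

theorem toFace_hasRank (a : CosetFace (stgVoltage hP G) B) : HasRank (toFace a) (a.rank : ℕ) :=
  hasRank_faceAct (hP.face_hasRank _ _) _

theorem toFace_act (γ : G) (a : CosetFace (stgVoltage hP G) B) :
    toFace (CosetFace.act γ a) = faceAct (toFace a) (γ : AutGroup P) := by
  obtain ⟨g, hg⟩ := coset_nonempty a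
  have h : g * γ ∈ (CosetFace.act γ a).coset := by
    change g * γ ∈ MulOpposite.op γ • a.coset
    rwa [mem_rightCoset_iff, mul_inv_cancel_right]
  rw [← mem_coset.1 h, ← mem_coset.1 hg, ← faceAct_mul]
  rfl

/-- A face of `P` determines the component, hence the base vertex, and then the coset, which
consists of all elements taking the face of the base flag to it. -/
theorem toFace_injective :
    Function.Injective (toFace : CosetFace (stgVoltage hP G) B → P) := by
  intro a b e
  have hmem : ∀ g : G, g ∈ a.coset ↔ faceAct (baseFace a) (g : AutGroup P) = toFace a :=
    fun g => mem_coset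
  have hmem' : ∀ g : G, g ∈ b.coset ↔ faceAct (baseFace b) (g : AutGroup P) = toFace a := by
    intro g
    rw [e]
    exact mem_coset
  have hrank : a.rank = b.rank :=
    Fin.ext ((toFace_hasRank a).unique (by rw [e]; exact toFace_hasRank b))
  obtain ⟨g, hg⟩ := coset_nonempty a
  obtain ⟨h, hh⟩ := coset_nonempty b
  rw [hmem] at hg
  rw [hmem'] at hh
  clear e
  generalize toFace a = F at *
  obtain ⟨i, C, S, hS⟩ := a
  obtain ⟨j, C', S', hS'⟩ := b
  obtain rfl : i = j := hrank
  have hC : C = C' := by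
    have := component_eq_of_face (hg.trans hh.symm)
    rwa [B.base_mem, B.base_mem] at this
  subst hC
  have hSS : S = S' := Set.ext fun k => (hmem k).trans (hmem' k).symm
  subst hSS
  rfl

/-- The left translate `α_i^y H γ` consists of the elements taking the `i`-face of the base flag
of `y` to the face represented by `(C, H γ)`. -/
theorem mem_voltage_smul_coset {a : CosetFace (stgVoltage hP G) B}
    {y : (symmetryTypeGraph hP G).V} (hy : (symmetryTypeGraph hP G).component {a.rank}ᶜ y = a.comp)
    {g : G} :
    g ∈ (stgVoltage hP G).voltage (B.path a.rank y) • a.coset ↔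
      faceAct (hP.face (baseFlag hP G y) a.rank) (g : AutGroup P) = toFace a := by
  have hW := hP.agreeOff_compl_singleton.1 (agreeOff_voltage (B.path a.rank y))
  rw [Set.mem_smul_set_iff_inv_smul_mem, mem_coset, smul_eq_mul]
  have hb : baseFace a = faceAct (hP.face (baseFlag hP G y) a.rank)
      ((stgVoltage hP G).voltage (B.path a.rank y) : AutGroup P) := by
    rw [← hP.face_flagAct, ← hW, baseFace, hy]
  rw [hb, ← faceAct_mul, Subgroup.coe_mul, Subgroup.coe_inv, mul_inv_cancel_left]

/-- If `F` lies in the image under `g` of the base flag of `y`, it is represented by the coset of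
`(α_i^y)⁻¹ g`. -/
theorem exists_toFace_eq {F : P} {i : Fin n} (hF : HasRank F (i : ℕ)) :
    ∃ a : CosetFace (stgVoltage hP G) B, a.rank = i ∧ toFace a = F := by
  obtain ⟨Φ, hΦ⟩ := exists_flag_mem F
  obtain ⟨g, hg⟩ := exists_baseFlag_act (hP := hP) (G := G) Φ
  set y := flagOrbit hP G Φ
  set α := (stgVoltage hP G).voltage (B.path i y)
  let a : CosetFace (stgVoltage hP G) B :=
    { rank := i
      comp := (symmetryTypeGraph hP G).component {i}ᶜ y
      coset := MulOpposite.op (α⁻¹ * g) • ((stgVoltage hP G).voltageGroup {i}ᶜ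
        (B.base i ((symmetryTypeGraph hP G).component {i}ᶜ y)) : Set G)
      isCoset := ⟨_, rfl⟩ }
  have ha : g ∈ α • a.coset := by
    rw [Set.mem_smul_set_iff_inv_smul_mem, smul_eq_mul, mem_rightCoset_iff, mul_inv_cancel]
    exact one_mem _
  refine ⟨a, rfl, ?_⟩
  rw [← (mem_voltage_smul_coset rfl).1 ha, ← hP.face_flagAct, hg]
  exact (hP.eq_face hΦ hF).symm

/-- Incidence in the coset geometry means that the two faces lie in a common flag, namely the image
of the base flag of `y` under an element of the intersection. -/
theorem lt_iff_toFace_lt {a b : CosetFace (stgVoltage hP G) B} :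
    a < b ↔ toFace a < toFace b := by
  constructor
  · rintro ⟨hr, y, hya, hyb, g, hga, hgb⟩
    rw [mem_voltage_smul_coset hya, ← hP.face_flagAct] at hga
    rw [mem_voltage_smul_coset hyb, ← hP.face_flagAct] at hgb
    refine lt_of_height_lt (Φ := flagAct (baseFlag hP G y) (g : AutGroup P))
      (hga ▸ hP.face_mem _ _) (hgb ▸ hP.face_mem _ _) ?_
    exact ((toFace_hasRank a).height_lt_height_iff (toFace_hasRank b)).2 hr
  · intro h
    obtain ⟨Φ, ha, hb⟩ := exists_flag_mem_mem h.le
    obtain ⟨g, hg⟩ := exists_baseFlag_act (hP := hP) (G := G) Φ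
    have key : ∀ c : CosetFace (stgVoltage hP G) B, toFace c ∈ Φ →
        faceAct (hP.face (baseFlag hP G (flagOrbit hP G Φ)) c.rank) (g : AutGroup P) = toFace c :=
      fun c hc => by rw [← hP.face_flagAct, hg, ← hP.eq_face hc (toFace_hasRank c)]
    have hcomp : ∀ c : CosetFace (stgVoltage hP G) B, toFace c ∈ Φ →
        (symmetryTypeGraph hP G).component {c.rank}ᶜ (flagOrbit hP G Φ) = c.comp := by
      intro c hc
      have := component_eq_of_face ((key c hc).trans (rfl : toFace c = faceAct (baseFace c) _))
      rwa [B.base_mem] at this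
    refine ⟨((toFace_hasRank a).height_lt_height_iff (toFace_hasRank b)).1 (hP.height_lt h),
      flagOrbit hP G Φ, hcomp a ha, hcomp b hb, g, ?_, ?_⟩
    · exact (mem_voltage_smul_coset (hcomp a ha)).2 (key a ha)
    · exact (mem_voltage_smul_coset (hcomp b hb)).2 (key b hb)

/-! ### The isomorphism with the coset geometry -/

theorem IsAbstractPolytope.bot_lt_top (hP : IsAbstractPolytope P n) : (⊥ : P) < ⊤ := by
  refine bot_le.lt_of_ne fun e => ?_
  obtain ⟨Φ, -⟩ := exists_flag_mem (⊥ : P)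
  obtain ⟨F, -, hF⟩ := hP.exists_mem_height Φ (k := 1) (by omega)
  rw [le_antisymm (e ▸ le_top : F ≤ ⊥) bot_le, Order.height_bot] at hF
  norm_num at hF

theorem HasRank.bot_lt {F : P} {i : ℕ} (h : HasRank F i) : ⊥ < F := by
  rw [bot_lt_iff_ne_bot]
  rintro rfl
  rw [HasRank, Order.height_bot] at h
  norm_cast at h

theorem IsAbstractPolytope.height_top (hP : IsAbstractPolytope P n) :
    Order.height (⊤ : P) = ((n + 1 : ℕ) : ℕ∞) := by
  obtain ⟨Φ, -⟩ := exists_flag_mem (⊥ : P)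
  obtain ⟨F, -, hF⟩ := hP.exists_mem_height Φ le_rfl
  exact le_antisymm (hP.height_le _) (hF ▸ Order.height_mono le_top)

theorem HasRank.lt_top (hP : IsAbstractPolytope P n) {F : P} {i : Fin n}
    (h : HasRank F (i : ℕ)) : F < ⊤ := by
  rw [lt_top_iff_ne_top]
  rintro rfl
  rw [HasRank, hP.height_top] at h
  norm_cast at h
  omega

theorem IsAbstractPolytope.eq_bot_or_eq_top_or_hasRank (hP : IsAbstractPolytope P n) (F : P) :
    F = ⊥ ∨ F = ⊤ ∨ ∃ i : Fin n, HasRank F (i : ℕ) := by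
  obtain ⟨k, hk⟩ := ENat.ne_top_iff_exists.1 ((hP.height_le F).trans_lt (ENat.natCast_lt_top _)).ne
  have hle := hP.height_le F
  rw [← hk] at hle
  norm_cast at hle
  by_cases h0 : F = ⊥
  · exact Or.inl h0
  by_cases h1 : F = ⊤
  · exact Or.inr (Or.inl h1)
  have hlo := hP.height_lt (bot_lt_iff_ne_bot.2 h0)
  have hhi := hP.height_lt (lt_top_iff_ne_top.2 h1)
  rw [hP.height_top, ← hk] at hhi
  rw [Order.height_bot, ← hk] at hlo
  norm_cast at hlo hhi
  refine Or.inr (Or.inr ⟨⟨k - 1, by omega⟩, ?_⟩)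
  rw [HasRank, ← hk]
  norm_cast
  simp only
  omega

variable (hP G B) in
/-- The face of `P` represented by a face of the coset geometry, including the least and the
greatest one. -/
noncomputable def geometryToFace (F : CosetGeometry (stgVoltage hP G) B) : P :=
  WithBot.recBotCoe (C := fun _ => P) ⊥
    (fun F' => WithTop.recTopCoe (C := fun _ => P) ⊤ toFace F') F

theorem cosetGeometry_cases (F : CosetGeometry (stgVoltage hP G) B) :
    F = ⊥ ∨
      F = ((⊤ : WithTop (CosetFace (stgVoltage hP G) B)) : CosetGeometry (stgVoltage hP G) B) ∨
      ∃ a : CosetFace (stgVoltage hP G) B,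
        F = ((a : WithTop (CosetFace (stgVoltage hP G) B)) :
          CosetGeometry (stgVoltage hP G) B) := by
  induction F using WithBot.recBotCoe with
  | bot => exact Or.inl rfl
  | coe F =>
    induction F using WithTop.recTopCoe with
    | top => exact Or.inr (Or.inl rfl)
    | coe a => exact Or.inr (Or.inr ⟨a, rfl⟩)

theorem geometryToFace_lt_iff (F F' : CosetGeometry (stgVoltage hP G) B) :
    geometryToFace hP G B F < geometryToFace hP G B F' ↔ F < F' := by
  rcases cosetGeometry_cases F with rfl | rfl | ⟨a, rfl⟩ <;>
    rcases cosetGeometry_cases F' with rfl | rfl | ⟨b, rfl⟩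
  · exact iff_of_false (lt_irrefl (⊥ : P)) (WithBot.not_lt_bot _)
  · exact iff_of_true hP.bot_lt_top (WithBot.bot_lt_coe _)
  · exact iff_of_true (toFace_hasRank b).bot_lt (WithBot.bot_lt_coe _)
  · exact iff_of_false (not_top_lt (a := (⊥ : P))) (WithBot.not_lt_bot _)
  · exact iff_of_false (not_top_lt (a := (⊤ : P)))
      fun h => WithTop.not_top_lt _ (WithBot.coe_lt_coe.1 h)
  · exact iff_of_false (not_top_lt (a := toFace b))
      fun h => WithTop.not_top_lt _ (WithBot.coe_lt_coe.1 h)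
  · exact iff_of_false (not_lt_bot (a := toFace a)) (WithBot.not_lt_bot _)
  · exact iff_of_true ((toFace_hasRank a).lt_top hP)
      (WithBot.coe_lt_coe.2 (WithTop.coe_lt_top a))
  · rw [WithBot.coe_lt_coe, WithTop.coe_lt_coe]
    exact lt_iff_toFace_lt.symm

theorem geometryToFace_injective : Function.Injective (geometryToFace hP G B) := by
  intro F F' e
  rcases cosetGeometry_cases F with rfl | rfl | ⟨a, rfl⟩ <;>
    rcases cosetGeometry_cases F' with rfl | rfl | ⟨b, rfl⟩
  · rfl
  · exact absurd e hP.bot_lt_top.ne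
  · exact absurd e (toFace_hasRank b).bot_lt.ne
  · exact absurd e hP.bot_lt_top.ne'
  · rfl
  · exact absurd e ((toFace_hasRank b).lt_top hP).ne'
  · exact absurd e (toFace_hasRank a).bot_lt.ne'
  · exact absurd e ((toFace_hasRank a).lt_top hP).ne
  · rw [toFace_injective (show toFace a = toFace b from e)]

theorem geometryToFace_surjective : Function.Surjective (geometryToFace hP G B) := by
  intro F
  rcases hP.eq_bot_or_eq_top_or_hasRank F with rfl | rfl | ⟨i, hi⟩
  · exact ⟨⊥, rfl⟩
  · exact ⟨((⊤ : WithTop (CosetFace (stgVoltage hP G) B)) :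
      CosetGeometry (stgVoltage hP G) B), rfl⟩
  · obtain ⟨a, -, rfl⟩ := exists_toFace_eq (G := G) (B := B) hi
    exact ⟨((a : WithTop (CosetFace (stgVoltage hP G) B)) :
      CosetGeometry (stgVoltage hP G) B), rfl⟩

theorem geometryToFace_act (F : CosetGeometry (stgVoltage hP G) B) (γ : G) :
    geometryToFace hP G B (F.act γ) = faceAct (geometryToFace hP G B F) (γ : AutGroup P) := by
  rcases cosetGeometry_cases F with rfl | rfl | ⟨a, rfl⟩
  · exact (map_bot (γ : AutGroup P).unop).symm
  · exact (map_top (γ : AutGroup P).unop).symm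
  · exact toFace_act γ a

theorem exists_cosetGeometry_iso (B : BaseData (symmetryTypeGraph hP G)) :
    ∃ φ : P ≃ CosetGeometry (stgVoltage hP G) B,
      (∀ F F' : P, F < F' ↔ φ F < φ F') ∧
      (∀ (F : P) (i : Fin n), HasRank F (i : ℕ) ↔
        ∃ a : CosetFace (stgVoltage hP G) B,
          φ F = ((a : WithTop (CosetFace (stgVoltage hP G) B)) :
            CosetGeometry (stgVoltage hP G) B) ∧ a.rank = i) ∧
      (∀ (F : P) (γ : G), φ (faceAct F (γ : AutGroup P)) = (φ F).act γ) := by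
  let e : CosetGeometry (stgVoltage hP G) B ≃ P :=
    Equiv.ofBijective (geometryToFace hP G B) ⟨geometryToFace_injective, geometryToFace_surjective⟩
  refine ⟨e.symm, fun F F' => ?_, fun F i => ⟨fun h => ?_, ?_⟩, fun F γ => ?_⟩
  · rw [← geometryToFace_lt_iff]
    change _ ↔ e (e.symm F) < e (e.symm F')
    rw [Equiv.apply_symm_apply, Equiv.apply_symm_apply]
  · obtain ⟨a, ha, rfl⟩ := exists_toFace_eq (G := G) (B := B) h
    exact ⟨a, e.symm_apply_eq.2 rfl, ha⟩
  · rintro ⟨a, ha, rfl⟩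
    rw [e.symm_apply_eq.1 ha]
    exact toFace_hasRank a
  · rw [e.symm_apply_eq]
    refine Eq.trans ?_ (geometryToFace_act (e.symm F) γ).symm
    exact congrArg (fun F' => faceAct F' (γ : AutGroup P)) (e.apply_symm_apply F).symm

end Faces

end PolytopeCoset

open PolytopeCoset PolytopeCoset.ColoredGraph

theorem mainTheorem1 {P : Type u} [PartialOrder P] [BoundedOrder P] (n : ℕ)
    (hP : IsAbstractPolytope P n) (G : Subgroup (AutGroup P)) :
    (symmetryTypeGraph hP G).IsPremaniplex ∧
    ∃ ξ : VoltageAssignment (symmetryTypeGraph hP G) G,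
      -- the derived graph of `ξ` is the flag graph of `P`, compatibly with the actions of `G`
      (∃ θ : (flagGraph hP).V ≃ ξ.derivedGraph.V,
        (∀ (i : Fin n) (Φ : (flagGraph hP).V),
          θ ((flagGraph hP).nbr i Φ) = ξ.derivedGraph.nbr i (θ Φ)) ∧
        (∀ Φ : Flag P, (θ Φ).1 = flagOrbit hP G Φ) ∧
        (∀ (Φ : Flag P) (γ : G), θ (flagAct Φ (γ : AutGroup P)) = ((θ Φ).1, (θ Φ).2 * γ))) ∧
      ξ.IntersectionProperty ∧
      -- `P` is isomorphic to the coset geometry, whatever choices are made in its construction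
      ∀ B : BaseData (symmetryTypeGraph hP G),
        ∃ φ : P ≃ CosetGeometry ξ B,
          (∀ F F' : P, F < F' ↔ φ F < φ F') ∧
          (∀ (F : P) (i : Fin n), HasRank F (i : ℕ) ↔
            ∃ a : CosetFace ξ B, φ F = ((a : WithTop (CosetFace ξ B)) : CosetGeometry ξ B) ∧
              a.rank = i) ∧
          (∀ (F : P) (γ : G), φ (faceAct F (γ : AutGroup P)) = (φ F).act γ) := by
  refine ⟨symmetryTypeGraph_isPremaniplex, stgVoltage hP G, exists_derivedGraph_iso,
    stgVoltage_intersectionProperty, exists_cosetGeometry_iso⟩
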